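/- Let $\eta>1$, let $m,n\ge 1$, and let $X_1,\dots,X_m$ and $Y_1,\dots,Y_n$ be independent random samples from continuous distribution functions $F$ and $G$, respectively, where $G$ satisfies the Lehmann alternative $$H_{LE}:\quad G(x)=1-(1-F(x))^{1/\eta}.$$ Write $X_{(1)}\le\dots\le X_{(m)}$ and $Y_{(1)}\le\dots\le Y_{(n)}$ for the order statistics. For integers $0\le s<m$ and $0\le r<n$ let $A_s$ be the number of $Y$-observations larger than $X_{(m-s)}$ and let $B_r$ be the number of $X$-observations smaller than $Y_{(1+r)}$. Then for all integers $k,i\ge 0$, $$P(A_s=k,\,B_r=i)=\begin{cases} \dfrac{m!\,n!\,(1/\eta)}{r!\,s!\,(n-k-r-1)!\,k!}\,S_p\,S_z, & 0\le i\le m-s-1,\ 0\le k\le n-r-1,\\[2ex] \dfrac{m!\,n!\,\eta}{(n-r-1)!\,(m-s-1)!\,(i-m+s)!\,(m-i)!}\,S_p'\,S_z', & m-s\le i\le m,\ n-r\le k\le n,\\[2ex] 0, & \text{otherwise,} \end{cases}$$ where $$S_p=\sum_{p=0}^{r}(-1)^p\binom{r}{p}\frac{\Gamma(m-i+(n-r+p)/\eta)}{\Gamma(m+(n-r+p)/\eta+1)},$$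 $$S_z=\sum_{z=0}^{n-k-r-1}(-1)^z\binom{n-k-r-1}{z}\frac{\Gamma(s+(z+k)/\eta+1)}{\Gamma(m-i+(z+k)/\eta+1)},$$ $$S_p'=\sum_{p=0}^{i-m+s}(-1)^p\binom{i-m+s}{p}\frac{\Gamma(n-r+(m-i+p)\eta)}{\Gamma(k+(m-i+p)\eta+1)},$$ $$S_z'=\sum_{z=0}^{m-s-1}(-1)^z\binom{m-s-1}{z}\frac{\Gamma(k+(z+s+1)\eta)}{\Gamma(n+(z+s+1)\eta+1)}.$$ Consequently, for $0\le\rho<1$, the statistic $V_\rho=A_s+B_r$ with $s=\lfloor\rho m\rfloor$ and $r=\lfloor\rho n\rfloor$ satisfies, for every integer $v\ge 0$, $$P(V_\rho\le v)=\sum_{i=0}^{v}\sum_{k=0}^{v-i}P(A_s=k,\,B_r=i),$$ with the probabilities on the right given by the formulas above; and $V_\rho$ is distribution-free under $H_{LE}$: for given $m,n,\rho,\eta$ its law is the same for every continuous distribution function $F$. -/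

import Mathlib

open MeasureTheory ProbabilityTheory

noncomputable section

/-- The order statistics of a sample `x` of size `m`, in nondecreasing order. The index starts at
`0`: `orderStat x ⟨j, _⟩` is the `(j + 1)`-th smallest observation `x_{(j+1)}`. -/
def orderStat {m : ℕ} (x : Fin m → ℝ) (j : Fin m) : ℝ :=
  x (Tuple.sort x j)

/-- `A_s`: the number of `y`-observations larger than `x_{(m-s)}`
(the index `m - s - 1` counted from `0`). -/
def exceedance {m n : ℕ} (s : ℕ) (hs : s < m) (x : Fin m → ℝ) (y : Fin n → ℝ) : ℕ :=
  (Finset.univ.filter fun j : Fin n => orderStat x ⟨m - s - 1, by omega⟩ < y j).card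

/-- `B_r`: the number of `x`-observations smaller than `y_{(1+r)}`
(the index `r` counted from `0`). -/
def precedence {m n : ℕ} (r : ℕ) (hr : r < n) (x : Fin m → ℝ) (y : Fin n → ℝ) : ℕ :=
  (Finset.univ.filter fun j : Fin m => x j < orderStat y ⟨r, hr⟩).card

theorem floor_mul_lt {ρ : ℝ} (hρ : ρ < 1) {m : ℕ} (hm : 0 < m) : ⌊ρ * m⌋₊ < m := by
  have hm' : (0 : ℝ) < m := by exact_mod_cast hm
  exact (Nat.floor_lt' hm.ne').2 (by nlinarith)

/-- The statistic `V_ρ = A_s + B_r` with `s = [ρ m]` and `r = [ρ n]`. -/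
def sidakStat {m n : ℕ} (ρ : ℝ) (hρ : ρ < 1) (hm : 0 < m) (hn : 0 < n)
    (x : Fin m → ℝ) (y : Fin n → ℝ) : ℕ :=
  exceedance ⌊ρ * m⌋₊ (floor_mul_lt hρ hm) x y + precedence ⌊ρ * n⌋₊ (floor_mul_lt hρ hn) x y

/-- `X_1, …, X_m` and `Y_1, …, Y_n` are independent random samples (all `m + n` variables are
mutually independent) from the continuous distribution functions `F` and
`G = 1 - (1 - F) ^ (1 / η)`, respectively. -/
structure IsLehmannTwoSample {Ω : Type*} [MeasurableSpace Ω] (P : Measure Ω) {m n : ℕ}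
    (η : ℝ) (F : ℝ → ℝ) (X : Fin m → Ω → ℝ) (Y : Fin n → Ω → ℝ) : Prop where
  continuous_F : Continuous F
  measurable_X : ∀ j, Measurable (X j)
  measurable_Y : ∀ j, Measurable (Y j)
  indep : iIndepFun (Sum.elim X Y) P
  cdf_X : ∀ j t, P.real {ω | X j ω ≤ t} = F t
  cdf_Y : ∀ j t, P.real {ω | Y j ω ≤ t} = 1 - (1 - F t) ^ (1 / η)

/-- The sum `S_p`. -/
def lehmannSp (m n r : ℕ) (η : ℝ) (i : ℕ) : ℝ :=
  ∑ p ∈ Finset.range (r + 1), (-1 : ℝ) ^ p * (r.choose p : ℝ) *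
    (Real.Gamma ((m : ℝ) - i + ((n : ℝ) - r + p) / η) /
      Real.Gamma ((m : ℝ) + ((n : ℝ) - r + p) / η + 1))

/-- The sum `S_z`. -/
def lehmannSz (m n s r : ℕ) (η : ℝ) (k i : ℕ) : ℝ :=
  ∑ z ∈ Finset.range (n - k - r - 1 + 1), (-1 : ℝ) ^ z * ((n - k - r - 1).choose z : ℝ) *
    (Real.Gamma ((s : ℝ) + ((z : ℝ) + k) / η + 1) /
      Real.Gamma ((m : ℝ) - i + ((z : ℝ) + k) / η + 1))

/-- The sum `S_p'`. -/
def lehmannSp' (m n s r : ℕ) (η : ℝ) (k i : ℕ) : ℝ :=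
  ∑ p ∈ Finset.range (i + s - m + 1), (-1 : ℝ) ^ p * ((i + s - m).choose p : ℝ) *
    (Real.Gamma ((n : ℝ) - r + ((m : ℝ) - i + p) * η) /
      Real.Gamma ((k : ℝ) + ((m : ℝ) - i + p) * η + 1))

/-- The sum `S_z'`. -/
def lehmannSz' (m n s : ℕ) (η : ℝ) (k : ℕ) : ℝ :=
  ∑ z ∈ Finset.range (m - s - 1 + 1), (-1 : ℝ) ^ z * ((m - s - 1).choose z : ℝ) *
    (Real.Gamma ((k : ℝ) + ((z : ℝ) + s + 1) * η) /
      Real.Gamma ((n : ℝ) + ((z : ℝ) + s + 1) * η + 1))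

open scoped Nat in
/-- The claimed value of `P (A_s = k, B_r = i)`, for `s < m` and `r < n`. In each of the two
regions none of the natural-number subtractions used there truncates. -/
def lehmannPmf (m n s r : ℕ) (η : ℝ) (k i : ℕ) : ℝ :=
  if i ≤ m - s - 1 ∧ k ≤ n - r - 1 then
    ((m ! : ℝ) * (n ! : ℝ) * (1 / η)) /
        ((r ! : ℝ) * (s ! : ℝ) * ((n - k - r - 1)! : ℝ) * (k ! : ℝ)) *
      lehmannSp m n r η i * lehmannSz m n s r η k i
  else if (m - s ≤ i ∧ i ≤ m) ∧ (n - r ≤ k ∧ k ≤ n) then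
    ((m ! : ℝ) * (n ! : ℝ) * η) /
        (((n - r - 1)! : ℝ) * ((m - s - 1)! : ℝ) * ((i + s - m)! : ℝ) * ((m - i)! : ℝ)) *
      lehmannSp' m n s r η k i * lehmannSz' m n s η k
  else 0

end

-- The counts depend only on the relative order of the observations. The map `1 - F` reverses this
-- order outside a null event and, by the probability integral transform, makes the `X`'s uniform on
-- `(0, 1)` and gives the `Y`'s the distribution function `t ^ a`, with `a = 1 / η`
-- (`map_one_sub_cdf`, `IsLehmannTwoSample.map_eq_pi`). Thus `F` disappears, which is the source of
-- distribution-freeness.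
--
-- Suppose `Y_{(1+r)} < X_{(m-s)}`, and let `u < v` be the transformed values of `X_{(m-s)}` and
-- `Y_{(1+r)}`. Then `A_s = k`, `B_r = i` says that `i` of the `X`'s and `r` of the `Y`'s lie above
-- `v`, while `s` of the `X`'s and `k` of the `Y`'s lie below `u`. Without ties exactly one pair of
-- observations plays this role, so the probability is a sum over all pairs. For given `u` and `v`
-- the other observations contribute two multinomial probabilities (`pi_real_card_eq`,
-- `pi_real_extremePairEvent`). The remaining double integral over `0 < u < v < 1` factorizes under
-- `u = v t`, because `v - u` and `v ^ a - u ^ a` are homogeneous (`integral_integral_powerLaw`).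
-- Binomial expansion turns the two factors into alternating sums of Beta integrals, which are `S_p`
-- and `S_z`.
--
-- In the opposite order the samples are exchanged: `η` becomes `1 / η`, and `(s, r, k, i)` becomes
-- `(n - r - 1, m - s - 1, m - i, n - k)`. The two orders force the two regions of the formula
-- (`precedence_exceedance_bounds`), so elsewhere the probability is zero.

-- Power laws and the probability integral transform

/-- The law on `(0, 1)` with distribution function `t ↦ t ^ a`. -/
noncomputable def powerLaw (a : ℝ) : Measure ℝ :=
  (volume.restrict (Set.Ioo 0 1)).withDensity (fun u => ENNReal.ofReal (a * u ^ (a - 1)))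

theorem powerLaw_Iic {a t : ℝ} (ha : 0 < a) (h0 : 0 ≤ t) (h1 : t ≤ 1) :
    powerLaw a (Set.Iic t) = ENNReal.ofReal (t ^ a) := by
  have hint : IntegrableOn (fun u : ℝ => a * u ^ (a - 1)) (Set.Ioc 0 t) := by
    have := (intervalIntegral.intervalIntegrable_rpow' (a := 0) (b := t)
      (show (-1 : ℝ) < a - 1 by linarith)).const_mul a
    exact (intervalIntegrable_iff_integrableOn_Ioc_of_le h0).1 this
  have hval : ∫ u in Set.Ioc 0 t, a * u ^ (a - 1) = t ^ a := by
    rw [← intervalIntegral.integral_of_le h0, intervalIntegral.integral_const_mul,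
      integral_rpow (Or.inl (by linarith))]
    simp [ha.ne', Real.zero_rpow]
    field_simp
  rw [powerLaw, withDensity_apply _ measurableSet_Iic, Measure.restrict_restrict measurableSet_Iic,
    Set.inter_comm]
  have hset : (Set.Ioo (0 : ℝ) 1 ∩ Set.Iic t : Set ℝ) =ᵐ[volume] Set.Ioc 0 t := by
    have h : (Set.Ioc (0 : ℝ) 1 ∩ Set.Iic t : Set ℝ) = Set.Ioc 0 t := by
      ext x; simp only [Set.mem_inter_iff, Set.mem_Ioc, Set.mem_Iic]
      constructor
      · rintro ⟨⟨a, b⟩, c⟩; exact ⟨a, c⟩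
      · rintro ⟨a, b⟩; exact ⟨⟨a, b.trans h1⟩, b⟩
    rw [← h]
    exact Ioo_ae_eq_Ioc.inter (ae_eq_refl _)
  rw [setLIntegral_congr hset, ← hval, ofReal_integral_eq_lintegral_ofReal hint]
  filter_upwards [ae_restrict_mem measurableSet_Ioc] with u hu
  have := Real.rpow_nonneg hu.1.le (a - 1)
  positivity

theorem powerLaw_univ {a : ℝ} (ha : 0 < a) : powerLaw a Set.univ = 1 := by
  have h := powerLaw_Iic ha zero_le_one le_rfl
  have h2 : powerLaw a Set.univ = powerLaw a (Set.Iic 1) := by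
    refine le_antisymm ?_ (measure_mono (Set.subset_univ _))
    have h3 : powerLaw a (Set.Ioi 1) = 0 := by
      rw [powerLaw, withDensity_apply _ measurableSet_Ioi,
        Measure.restrict_restrict measurableSet_Ioi]
      have : Set.Ioi (1 : ℝ) ∩ Set.Ioo 0 1 = ∅ := by
        ext x; simp; intros; linarith
      simp [this]
    rw [← Set.Iic_union_Ioi (a := (1 : ℝ))]
    refine (measure_union_le _ _).trans ?_
    simp [h3]
  rw [h2, h]; simp

theorem isProbabilityMeasure_powerLaw {a : ℝ} (ha : 0 < a) : IsProbabilityMeasure (powerLaw a) :=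
  ⟨powerLaw_univ ha⟩

instance nullSingletonClass_powerLaw (a : ℝ) : NullSingletonClass (powerLaw a) := by
  unfold powerLaw; infer_instance

theorem powerLaw_real_Iio {a t : ℝ} (ha : 0 < a) (h0 : 0 ≤ t) (h1 : t ≤ 1) :
    (powerLaw a).real (Set.Iio t) = t ^ a := by
  rw [measureReal_def, measure_congr Iio_ae_eq_Iic, powerLaw_Iic ha h0 h1,
    ENNReal.toReal_ofReal (Real.rpow_nonneg h0 _)]

theorem powerLaw_real_Ioi {a t : ℝ} (ha : 0 < a) (h0 : 0 ≤ t) (h1 : t ≤ 1) :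
    (powerLaw a).real (Set.Ioi t) = 1 - t ^ a := by
  have := isProbabilityMeasure_powerLaw ha
  rw [← Set.compl_Iic, probReal_compl_eq_one_sub measurableSet_Iic, measureReal_def,
    powerLaw_Iic ha h0 h1, ENNReal.toReal_ofReal (Real.rpow_nonneg h0 _)]

theorem ae_powerLaw_mem (a : ℝ) : ∀ᵐ u ∂(powerLaw a), u ∈ Set.Ioo (0 : ℝ) 1 :=
  (withDensity_absolutelyContinuous _ _).ae_le (ae_restrict_mem measurableSet_Ioo)

/-- If `Z` has distribution function `1 - (1 - F) ^ a`, then `1 - F (Z)` has law `powerLaw a`. -/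
theorem map_one_sub_cdf {Ω : Type*} [MeasurableSpace Ω] {P : Measure Ω} [IsProbabilityMeasure P]
    {F : ℝ → ℝ} (hc : Continuous F) (hmono : Monotone F)
    (hbot : Filter.Tendsto F Filter.atBot (nhds 0)) (htop : Filter.Tendsto F Filter.atTop (nhds 1))
    {a : ℝ} (ha : 0 < a) {Z : Ω → ℝ} (hZ : Measurable Z)
    (hcdf : ∀ t, P.real {ω | Z ω ≤ t} = 1 - (1 - F t) ^ a) :
    P.map (fun ω => 1 - F (Z ω)) = powerLaw a := by
  have hF0 : ∀ t, 0 ≤ F t := fun t => hmono.le_of_tendsto hbot t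
  have hF1 : ∀ t, F t ≤ 1 := fun t => hmono.ge_of_tendsto htop t
  have := isProbabilityMeasure_powerLaw ha
  have hm : Measurable (fun ω => 1 - F (Z ω)) := measurable_const.sub (hc.measurable.comp hZ)
  have := Measure.isProbabilityMeasure_map (μ := P) hm.aemeasurable
  -- Upper half-lines are tested because `1 - F` reverses order, so that their preimages are
  -- sublevel events of `F (Z)`.
  refine Measure.ext_of_Ici _ _ fun c => ?_
  rw [← ENNReal.toReal_eq_toReal_iff' (measure_ne_top _ _) (measure_ne_top _ _), ← measureReal_def,
    ← measureReal_def, map_measureReal_apply hm measurableSet_Ici]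
  have hpre : (fun ω => 1 - F (Z ω)) ⁻¹' Set.Ici c = {ω | F (Z ω) ≤ 1 - c} := by
    ext ω; simp only [Set.mem_preimage, Set.mem_Ici, Set.mem_ofPred_eq]
    constructor <;> intro h <;> linarith
  rw [hpre]
  rcases le_or_gt c 0 with hc0 | hc0
  · have h1 : {ω | F (Z ω) ≤ 1 - c} = Set.univ := by
      ext ω; simp only [Set.mem_ofPred_eq, Set.mem_univ, iff_true]; linarith [hF1 (Z ω)]
    have h2 : (powerLaw a).real (Set.Ici c) = (powerLaw a).real Set.univ := by
      refine measureReal_congr ?_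
      filter_upwards [ae_powerLaw_mem a] with u hu
      refine propext ⟨fun _ => trivial, fun _ => ?_⟩
      exact hc0.trans hu.1.le
    rw [h1, h2]; simp
  rcases lt_or_ge 1 c with hc1 | hc1
  · have h1 : {ω | F (Z ω) ≤ 1 - c} = ∅ := by
      ext ω; simp only [Set.mem_ofPred_eq, Set.mem_empty_iff_false, iff_false]
      linarith [hF0 (Z ω)]
    have h2 : (powerLaw a).real (Set.Ici c) = (powerLaw a).real ∅ := by
      refine measureReal_congr ?_
      filter_upwards [ae_powerLaw_mem a] with u hu
      refine propext ⟨fun h => ?_, fun h => h.elim⟩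
      exact absurd (hc1.trans_le h) hu.2.not_gt
    rw [h1, h2]; simp
  have hR : (powerLaw a).real (Set.Ici c) = 1 - c ^ a := by
    rw [← powerLaw_real_Ioi ha hc0.le hc1]
    exact measureReal_congr Ioi_ae_eq_Ici.symm
  rw [hR]
  -- `F` may have flat pieces and so no inverse. A nonempty sublevel set is the half-line up to its
  -- supremum `x₀`, where continuity gives equality. It can be empty only for `c = 1`, since `F`
  -- tends to `0` at minus infinity.
  by_cases hne : ∃ x, F x ≤ 1 - c
  · have hbdd : BddAbove {x | F x ≤ 1 - c} := by
      obtain ⟨y, hy⟩ := (htop.eventually (lt_mem_nhds (show 1 - c < 1 by linarith))).exists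
      refine ⟨y, fun x hx => ?_⟩
      by_contra h
      exact absurd (hmono (not_le.1 h).le) (not_le.2 (lt_of_le_of_lt hx hy))
    have hcl : IsClosed {x | F x ≤ 1 - c} := isClosed_le hc continuous_const
    have hmem : F (sSup {x | F x ≤ 1 - c}) ≤ 1 - c := hcl.csSup_mem hne hbdd
    set x₀ := sSup {x | F x ≤ 1 - c} with hx₀
    have heq : F x₀ = 1 - c := by
      refine le_antisymm hmem ?_
      by_contra h
      have h1 : ∀ᶠ y in nhds x₀, F y < 1 - c :=
        hc.continuousAt.eventually (gt_mem_nhds (not_le.1 h))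
      have h2 : ∀ᶠ y in nhdsWithin x₀ (Set.Ioi x₀), F y < 1 - c := h1.filter_mono nhdsWithin_le_nhds
      obtain ⟨y, hy, hy'⟩ := (h2.and self_mem_nhdsWithin).exists
      exact absurd (le_csSup hbdd hy.le) (not_le.2 hy')
    have hs : {ω | F (Z ω) ≤ 1 - c} = {ω | Z ω ≤ x₀} := by
      ext ω; constructor
      · intro h; exact le_csSup hbdd h
      · intro h; exact (hmono h).trans hmem
    rw [hs, hcdf, heq]; simp
  · push Not at hne
    have h1 : 1 - c ≤ 0 := ge_of_tendsto' hbot fun x => (hne x).le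
    have hc' : c = 1 := by linarith
    have h1 : {ω | F (Z ω) ≤ 1 - c} = ∅ := by
      ext ω; simp only [Set.mem_ofPred_eq, Set.mem_empty_iff_false, iff_false]
      exact not_le.2 (hne _)
    rw [h1, hc']; simp

/-- A distribution function has the expected monotonicity and limits. -/
theorem isCDF_of_real_le {Ω : Type*} [MeasurableSpace Ω] {P : Measure Ω} [IsProbabilityMeasure P]
    {F : ℝ → ℝ} {Z : Ω → ℝ} (hZ : Measurable Z) (hcdf : ∀ t, P.real {ω | Z ω ≤ t} = F t) :
    Monotone F ∧ Filter.Tendsto F Filter.atBot (nhds 0) ∧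
      Filter.Tendsto F Filter.atTop (nhds 1) := by
  have := Measure.isProbabilityMeasure_map (μ := P) hZ.aemeasurable
  have h : F = cdf (P.map Z) := by
    ext t
    rw [cdf_eq_real, map_measureReal_apply hZ measurableSet_Iic, ← hcdf]; rfl
  rw [h]
  exact ⟨monotone_cdf _, tendsto_cdf_atBot _, tendsto_cdf_atTop _⟩

/-- Exchanging the roles of the two samples replaces `η` by `1 / η`. -/
theorem IsLehmannTwoSample.swap {Ω : Type*} [MeasurableSpace Ω] {P : Measure Ω}
    [IsProbabilityMeasure P] {m n : ℕ} {η : ℝ} (hη : 0 < η) {F : ℝ → ℝ} {X : Fin m → Ω → ℝ}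
    {Y : Fin n → Ω → ℝ} (hm : 0 < m) (h : IsLehmannTwoSample P η F X Y) :
    IsLehmannTwoSample P (1 / η) (fun t => 1 - (1 - F t) ^ (1 / η)) Y X where
  continuous_F := by
    refine continuous_const.sub ((continuous_const.sub h.continuous_F).rpow_const ?_)
    intro x; right; positivity
  measurable_X := h.measurable_Y
  measurable_Y := h.measurable_X
  indep := by
    have := h.indep.precomp (g := Sum.swap) Sum.swap_leftInverse.injective
    convert this using 1
    ext z; cases z <;> rfl
  cdf_X := h.cdf_Y
  cdf_Y j t := by
    -- That `F` is a distribution function is known only through an actual observation `X`, hence `0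
    -- < m`; the bound `F t ≤ 1` is what allows the exponents to be multiplied.
    obtain ⟨hmono, -, htop⟩ := isCDF_of_real_le (h.measurable_X ⟨0, hm⟩) (h.cdf_X ⟨0, hm⟩)
    have hF1 : F t ≤ 1 := hmono.ge_of_tendsto htop t
    rw [h.cdf_X, sub_sub_cancel, ← Real.rpow_mul (by linarith)]
    have : 1 / η * (1 / (1 / η)) = 1 := by field_simp
    rw [this]; simp

/-- The law of the `l`-th transformed observation. -/
noncomputable def lehmannLaw (m n : ℕ) (η : ℝ) : Fin m ⊕ Fin n → Measure ℝ :=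
  Sum.elim (fun _ => powerLaw 1) (fun _ => powerLaw (1 / η))

theorem isProbabilityMeasure_lehmannLaw {m n : ℕ} {η : ℝ} (hη : 0 < η) (l : Fin m ⊕ Fin n) :
    IsProbabilityMeasure (lehmannLaw m n η l) := by
  cases l
  · exact isProbabilityMeasure_powerLaw one_pos
  · exact isProbabilityMeasure_powerLaw (one_div_pos.2 hη)

/-- The joint law of the observations transformed by `1 - F`. -/
theorem IsLehmannTwoSample.map_eq_pi {Ω : Type*} [MeasurableSpace Ω] {P : Measure Ω}
    [IsProbabilityMeasure P] {m n : ℕ} {η : ℝ} (hη : 0 < η) {F : ℝ → ℝ} {X : Fin m → Ω → ℝ}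
    {Y : Fin n → Ω → ℝ} (hm : 0 < m) (h : IsLehmannTwoSample P η F X Y) :
    P.map (fun ω l => 1 - F (Sum.elim X Y l ω)) = Measure.pi (lehmannLaw m n η) := by
  obtain ⟨hmono, hbot, htop⟩ := isCDF_of_real_le (h.measurable_X ⟨0, hm⟩) (h.cdf_X ⟨0, hm⟩)
  have hmeas : ∀ l, Measurable (Sum.elim X Y l) := by
    rintro (j | j)
    · exact h.measurable_X j
    · exact h.measurable_Y j
  have hg : Measurable (fun t => 1 - F t) := measurable_const.sub h.continuous_F.measurable
  have hind := h.indep.comp (fun _ t => 1 - F t) (fun _ => hg)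
  have := (iIndepFun_iff_map_fun_eq_pi_map (fun l => (hg.comp (hmeas l)).aemeasurable)).1 hind
  refine Eq.trans this ?_
  congr 1
  ext1 l
  rcases l with j | j
  · refine map_one_sub_cdf h.continuous_F hmono hbot htop one_pos (h.measurable_X j) fun t => ?_
    change P.real {ω | X j ω ≤ t} = _
    rw [h.cdf_X]; simp
  · exact map_one_sub_cdf h.continuous_F hmono hbot htop (one_div_pos.2 hη) (h.measurable_Y j)
      (h.cdf_Y j)

-- Almost sure absence of ties

/-- Two different coordinates of an atomless product measure differ almost surely. -/
theorem ae_pi_injective {ι : Type*} [Fintype ι] (μ : ι → Measure ℝ)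
    [∀ l, IsProbabilityMeasure (μ l)] [∀ l, NullSingletonClass (μ l)] :
    ∀ᵐ z ∂(Measure.pi μ), Function.Injective z := by
  have key : ∀ b c : ι, b ≠ c → ∀ᵐ z ∂(Measure.pi μ), z b ≠ z c := by
    intro b c hbc
    have hind : iIndepFun (fun l (z : ι → ℝ) => z l) (Measure.pi μ) :=
      iIndepFun_pi (X := fun _ => id) (fun _ => aemeasurable_id)
    -- The joint law of two coordinates is a product; by Fubini the diagonal is null, its sections
    -- being single points.
    have h2 := (indepFun_iff_map_prod_eq_prod_map_map (measurable_pi_apply b).aemeasurable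
      (measurable_pi_apply c).aemeasurable).1 (hind.indepFun hbc)
    have hev : ∀ l, (Measure.pi μ).map (fun z => z l) = μ l := fun l =>
      (measurePreserving_eval μ l).map_eq
    rw [hev, hev] at h2
    have h3 : ∀ᵐ w ∂((μ b).prod (μ c)), w.1 ≠ w.2 := by
      have hms : MeasurableSet {w : ℝ × ℝ | w.1 ≠ w.2} :=
        (measurableSet_eq_fun measurable_fst measurable_snd).compl
      rw [Measure.ae_prod_iff_ae_ae hms]
      refine Filter.Eventually.of_forall fun u => ?_
      have : ∀ᵐ v ∂(μ c), v ≠ u := by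
        rw [ae_iff]; simp
      filter_upwards [this] with v hv using hv.symm
    rw [← h2] at h3
    exact ae_of_ae_map ((measurable_pi_apply b).prodMk (measurable_pi_apply c)).aemeasurable h3
  have : ∀ᵐ z ∂(Measure.pi μ), ∀ b c : ι, b ≠ c → z b ≠ z c := by
    rw [ae_all_iff]; intro b
    rw [ae_all_iff]; intro c
    by_cases hbc : b = c
    · exact Filter.Eventually.of_forall fun _ h => absurd hbc h
    · filter_upwards [key b c hbc] with z hz _ using hz
  filter_upwards [this] with z hz b c hbc
  by_contra hne
  exact hz b c hne hbc

-- Order statistics through counts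

open Finset in
theorem card_filter_sort {m : ℕ} (x : Fin m → ℝ) (p : ℝ → Prop) [DecidablePred p] :
    #{t | p (x (Tuple.sort x t))} = #{t | p (x t)} := by
  refine Finset.card_bij (fun t _ => Tuple.sort x t) ?_ ?_ ?_
  · intro t ht; simpa using ht
  · intro t _ t' _ h; exact (Tuple.sort x).injective h
  · intro b hb
    exact ⟨(Tuple.sort x).symm b, by simpa using hb, by simp⟩

-- The sorting permutation varies with `x`, whereas the count is a sum of indicators; this is what
-- makes order statistics measurable.
open Finset in
theorem orderStat_lt_iff {m : ℕ} (x : Fin m → ℝ) (j : Fin m) (c : ℝ) :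
    orderStat x j < c ↔ (j : ℕ) < #{t | x t < c} := by
  have := Tuple.lt_card_lt_iff_apply_lt_of_monotone (j := j) (a := c) (Tuple.monotone_sort x)
  rw [← card_filter_sort x (fun t => t < c)]
  exact this.symm

theorem measurable_orderStat {m : ℕ} (j : Fin m) :
    Measurable (fun x : Fin m → ℝ => orderStat x j) := by
  refine measurable_of_Iio fun c => ?_
  have : (fun x : Fin m → ℝ => orderStat x j) ⁻¹' Set.Iio c =
      {x | (j : ℕ) < (Finset.univ.filter fun t => x t < c).card} := by
    ext x; exact orderStat_lt_iff x j c
  rw [this]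
  simp only [Finset.card_filter]
  refine measurableSet_lt measurable_const ?_
  refine Finset.measurable_sum _ fun l _ => ?_
  exact Measurable.ite (measurableSet_lt (measurable_pi_apply l) measurable_const)
    measurable_const measurable_const

theorem measurable_card_filter_lt {Ω ι : Type*} [MeasurableSpace Ω] [Fintype ι]
    {f g : ι → Ω → ℝ} (hf : ∀ l, Measurable (f l)) (hg : ∀ l, Measurable (g l)) :
    Measurable (fun w => (Finset.univ.filter fun l => f l w < g l w).card) := by
  simp only [Finset.card_filter]
  refine Finset.measurable_sum _ fun l _ => ?_
  exact Measurable.ite (measurableSet_lt (hf l) (hg l)) measurable_const measurable_const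

theorem measurable_exceedance {Ω : Type*} [MeasurableSpace Ω] {m n : ℕ} {X : Fin m → Ω → ℝ}
    {Y : Fin n → Ω → ℝ} (hX : ∀ j, Measurable (X j)) (hY : ∀ j, Measurable (Y j))
    {s : ℕ} (hs : s < m) :
    Measurable (fun ω => exceedance s hs (fun j => X j ω) (fun j => Y j ω)) :=
  measurable_card_filter_lt
    (fun _ => (measurable_orderStat _).comp (measurable_pi_lambda (fun ω j => X j ω) hX)) hY

theorem measurable_precedence {Ω : Type*} [MeasurableSpace Ω] {m n : ℕ} {X : Fin m → Ω → ℝ}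
    {Y : Fin n → Ω → ℝ} (hX : ∀ j, Measurable (X j)) (hY : ∀ j, Measurable (Y j))
    {r : ℕ} (hr : r < n) :
    Measurable (fun ω => precedence r hr (fun j => X j ω) (fun j => Y j ω)) :=
  measurable_card_filter_lt hX
    (fun _ => (measurable_orderStat _).comp (measurable_pi_lambda (fun ω j => Y j ω) hY))

theorem exists_orderStat_eq {m : ℕ} (x : Fin m → ℝ) (l : Fin m) : ∃ j, orderStat x j = x l :=
  ⟨(Tuple.sort x).symm l, by simp [orderStat]⟩

theorem strictMono_orderStat {m : ℕ} {x : Fin m → ℝ} (hx : Function.Injective x) :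
    StrictMono (orderStat x) :=
  (Tuple.monotone_sort x).strictMono_of_injective (hx.comp (Tuple.sort x).injective)

open Finset in
theorem card_lt_orderStat {m : ℕ} {x : Fin m → ℝ} (hx : Function.Injective x) (j : Fin m) :
    #{t | x t < orderStat x j} = (j : ℕ) := by
  rw [← card_filter_sort x (fun t => t < orderStat x j)]
  have : (univ.filter fun t => x (Tuple.sort x t) < orderStat x j) = Iio j := by
    ext t
    simp only [mem_filter, mem_univ, true_and, mem_Iio]
    exact (strictMono_orderStat hx).lt_iff_lt
  rw [this, Fin.card_Iio]

open Finset in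
theorem card_orderStat_lt {m : ℕ} {x : Fin m → ℝ} (hx : Function.Injective x) (j : Fin m) :
    #{t | orderStat x j < x t} = m - 1 - (j : ℕ) := by
  rw [← card_filter_sort x (fun t => orderStat x j < t)]
  have : (univ.filter fun t => orderStat x j < x (Tuple.sort x t)) = Ioi j := by
    ext t
    simp only [mem_filter, mem_univ, true_and, mem_Ioi]
    exact (strictMono_orderStat hx).lt_iff_lt
  rw [this, Fin.card_Ioi]

-- Without ties the number of smaller observations is the rank, so a count identifies an order
-- statistic.
open Finset in
theorem orderStat_eq_of_card_lt {m : ℕ} {x : Fin m → ℝ} (hx : Function.Injective x) {j l : Fin m}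
    (h : #{t | x t < x l} = (j : ℕ)) : orderStat x j = x l := by
  obtain ⟨u, hu⟩ := exists_orderStat_eq x l
  have := card_lt_orderStat hx u
  rw [hu, h] at this
  rw [Fin.ext this, hu]

open Finset in
theorem card_lt_add_card_gt {ι : Type*} [Fintype ι] {x : ι → ℝ} {q : ℝ} (h : ∀ t, x t ≠ q) :
    #{t | x t < q} + #{t | q < x t} = Fintype.card ι := by
  have : (univ.filter fun t => q < x t) = univ.filter fun t => ¬ x t < q := by
    ext t
    simp only [mem_filter, mem_univ, true_and, not_lt]
    exact ⟨le_of_lt, fun h' => lt_of_le_of_ne h' (h t).symm⟩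
  rw [this, Finset.card_filter_add_card_filter_not, card_univ]

-- Exchange of the two samples and the two possible orders

/-- Exchanging the samples turns exceedances into precedences. -/
theorem precedence_swap_add {m n s : ℕ} (hs : s < m) {x : Fin m → ℝ} {y : Fin n → ℝ}
    (hxy : ∀ i j, x i ≠ y j) :
    precedence (m - s - 1) (by omega) y x + exceedance s hs x y = n := by
  have := card_lt_add_card_gt (x := y) (q := orderStat x ⟨m - s - 1, by omega⟩)
    fun t => (hxy _ t).symm
  simpa using! this

/-- The reindexing `r ↦ n - r - 1` is an involution, so this is the previous identity with the
samples exchanged. -/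
theorem precedence_add_exceedance_swap {m n r : ℕ} (hr : r < n) {x : Fin m → ℝ} {y : Fin n → ℝ}
    (hxy : ∀ i j, x i ≠ y j) :
    precedence r hr x y + exceedance (n - r - 1) (by omega) y x = m := by
  have := precedence_swap_add (n := m) (s := n - r - 1) (m := n) (by omega) (x := y) (y := x)
    fun i j => (hxy j i).symm
  have h : n - (n - r - 1) - 1 = r := by omega
  simpa only [h] using this

open Finset in
/-- The two possible orders of `x_{(m-s)}` and `y_{(1+r)}`, read off from the two counts. -/
theorem precedence_exceedance_bounds {m n s r : ℕ} (hs : s < m) (hr : r < n) {x : Fin m → ℝ}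
    {y : Fin n → ℝ} (hx : Function.Injective x) (hy : Function.Injective y)
    (hxy : ∀ i j, x i ≠ y j) :
    (orderStat y ⟨r, hr⟩ < orderStat x ⟨m - s - 1, by omega⟩ ∧
      precedence r hr x y ≤ m - s - 1 ∧ exceedance s hs x y ≤ n - r - 1) ∨
    (m - s ≤ precedence r hr x y ∧ n - r ≤ exceedance s hs x y) := by
  -- Stated for arbitrary samples, because the opposite order is handled by the same bounds with the
  -- samples exchanged, followed by complementation.
  have key : ∀ {m n s r : ℕ} (hs : s < m) (hr : r < n) {x : Fin m → ℝ} {y : Fin n → ℝ}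
      (_ : Function.Injective x) (_ : Function.Injective y)
      (_ : orderStat y ⟨r, hr⟩ < orderStat x ⟨m - s - 1, by omega⟩),
      precedence r hr x y ≤ m - s - 1 ∧ exceedance s hs x y ≤ n - r - 1 := by
    intro m n s r hs hr x y hx hy hlt
    constructor
    · have := card_lt_orderStat hx ⟨m - s - 1, by omega⟩
      refine le_trans (card_le_card ?_) this.le
      exact monotone_filter_right _ fun t _ ht => lt_trans ht hlt
    · have := card_orderStat_lt hy ⟨r, hr⟩
      refine le_trans (card_le_card ?_) (this.trans (by simp; omega)).le
      exact monotone_filter_right _ fun t _ ht => lt_trans hlt ht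
  rcases lt_or_ge (orderStat y ⟨r, hr⟩) (orderStat x ⟨m - s - 1, by omega⟩) with h | h
  · exact Or.inl ⟨h, key hs hr hx hy h⟩
  · right
    have h' : orderStat x ⟨m - s - 1, by omega⟩ < orderStat y ⟨r, hr⟩ :=
      lt_of_le_of_ne h (hxy _ _)
    have e : n - (n - r - 1) - 1 = r := by omega
    have h2 := key (m := n) (n := m) (s := n - r - 1) (r := m - s - 1) (by omega) (by omega) hy hx
      (by simpa only [e] using h')
    have h3 := precedence_swap_add hs hxy
    have h4 := precedence_add_exceedance_swap hr hxy
    omega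

-- The event that a given pair occupies the two positions

open Finset in
/-- For transformed (order-reversed) observations `z`: the observations `inl p.1` and `inr p.2` are
`x_{(m-s)}` and `y_{(1+r)}`, in this order, with the prescribed numbers of further observations on
either side. -/
def extremePairEvent (m n i k s r : ℕ) (p : Fin m × Fin n) : Set (Fin m ⊕ Fin n → ℝ) :=
  {z | z (.inl p.1) < z (.inr p.2) ∧
    (#{l | z (.inr p.2) < z (.inl l)} = i ∧ #{l | z (.inl l) < z (.inl p.1)} = s) ∧
    #{l | z (.inr p.2) < z (.inr l)} = r ∧ #{l | z (.inr l) < z (.inl p.1)} = k}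

theorem measurableSet_extremePairEvent (m n i k s r : ℕ) (p : Fin m × Fin n) :
    MeasurableSet (extremePairEvent m n i k s r p) := by
  have hc : ∀ {ι : Type} [Fintype ι] {f g : ι → (Fin m ⊕ Fin n → ℝ) → ℝ} (_ : ∀ l, Measurable (f l))
      (_ : ∀ l, Measurable (g l)) (k : ℕ),
      MeasurableSet {w | (Finset.univ.filter fun l => f l w < g l w).card = k} :=
    fun hf hg k => measurable_card_filter_lt hf hg (measurableSet_singleton k)
  have h := fun (a : Fin m ⊕ Fin n) => measurable_pi_apply (X := fun _ => ℝ) a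
  refine (measurableSet_lt (h _) (h _)).inter ?_
  exact .inter (.inter (hc (fun _ => h _) (fun _ => h _) _) (hc (fun _ => h _) (fun _ => h _) _))
    (.inter (hc (fun _ => h _) (fun _ => h _) _) (hc (fun _ => h _) (fun _ => h _) _))

open Finset in
theorem eq_of_card_lt_eq {m : ℕ} {x : Fin m → ℝ} (hx : Function.Injective x) {a b : Fin m}
    (h : #{t | x t < x a} = #{t | x t < x b}) : a = b := by
  by_contra hab
  have key : ∀ a b : Fin m, x a < x b → #{t | x t < x a} < #{t | x t < x b} := by
    intro a b hlt
    refine card_lt_card ((ssubset_iff_of_subset ?_).2 ⟨a, by simpa using hlt, by simp⟩)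
    exact monotone_filter_right _ fun t _ ht => lt_trans ht hlt
  rcases lt_or_gt_of_ne (hx.ne hab) with h' | h'
  · exact (key _ _ h').ne h
  · exact (key _ _ h').ne h.symm

-- The counts `s` and `r` alone fix the ranks of the two distinguished observations, hence the
-- observations. This makes the events for different pairs disjoint off ties.
open Finset in
theorem extremePairEvent_unique {m n i k s r : ℕ} {p q : Fin m × Fin n} {z : Fin m ⊕ Fin n → ℝ}
    (hz : Function.Injective z) (hp : z ∈ extremePairEvent m n i k s r p)
    (hq : z ∈ extremePairEvent m n i k s r q) : p = q := by
  obtain ⟨-, ⟨-, h1⟩, h2, -⟩ := hp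
  obtain ⟨-, ⟨-, h3⟩, h4, -⟩ := hq
  have e1 : p.1 = q.1 := eq_of_card_lt_eq (x := fun l => z (.inl l))
    (hz.comp Sum.inl_injective) (h1.trans h3.symm)
  have e2 : p.2 = q.2 := by
    -- Negation turns the number of larger observations into a number of smaller ones.
    refine eq_of_card_lt_eq (x := fun l => -z (.inr l))
      (neg_injective.comp (hz.comp Sum.inr_injective)) ?_
    simpa only [neg_lt_neg_iff] using h2.trans h4.symm
  exact Prod.ext e1 e2

-- The counts `s` and `r` say that the pair is `x_{(m-s)}`, `y_{(1+r)}`; the counts `k` and `i` are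
-- then the exceedance and the precedence. The bound on `i` selects the order `y_{(1+r)} <
-- x_{(m-s)}`.
open Finset in
theorem exceedance_precedence_iff {m n s r i k : ℕ} (hs : s < m) (hr : r < n)
    (hi : i ≤ m - s - 1) {x : Fin m → ℝ} {y : Fin n → ℝ} {z : Fin m ⊕ Fin n → ℝ}
    (hinj : Function.Injective (Sum.elim x y))
    (hz : ∀ l l', Sum.elim x y l < Sum.elim x y l' ↔ z l' < z l) :
    (exceedance s hs x y = k ∧ precedence r hr x y = i) ↔
      ∃ p, z ∈ extremePairEvent m n i k s r p := by
  have hx : Function.Injective x := hinj.comp Sum.inl_injective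
  have hy : Function.Injective y := hinj.comp Sum.inr_injective
  have hxy : ∀ i j, x i ≠ y j := fun i j h =>
    Sum.inl_ne_inr (hinj (show Sum.elim x y (.inl i) = Sum.elim x y (.inr j) from h))
  have hE : ∀ p, z ∈ extremePairEvent m n i k s r p ↔ y p.2 < x p.1 ∧
      (#{l | x l < y p.2} = i ∧ #{l | x p.1 < x l} = s) ∧
      #{l | y l < y p.2} = r ∧ #{l | x p.1 < y l} = k := by
    intro p
    simp only [extremePairEvent, ← hz, Sum.elim_inl, Sum.elim_inr, Set.mem_ofPred_eq]
  simp only [hE]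
  constructor
  · rintro ⟨hk, hi'⟩
    obtain ⟨j, hj⟩ : ∃ j, orderStat y ⟨r, hr⟩ = y j := ⟨_, rfl⟩
    obtain ⟨j', hj'⟩ : ∃ j, orderStat x ⟨m - s - 1, by omega⟩ = x j := ⟨_, rfl⟩
    refine ⟨(j', j), ?_, ⟨?_, ?_⟩, ?_, ?_⟩
    · rcases precedence_exceedance_bounds hs hr hx hy hxy with h | h
      · rw [← hj, ← hj']; exact h.1
      · omega
    · rw [← hj]; exact hi'
    · rw [← hj', card_orderStat_lt hx]; simp; omega
    · rw [← hj, card_lt_orderStat hy]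
    · rw [← hj']; exact hk
  · rintro ⟨⟨j', j⟩, hlt, ⟨h1, h2⟩, h3, h4⟩
    have e1 : orderStat y ⟨r, hr⟩ = y j := orderStat_eq_of_card_lt hy h3
    have e2 : orderStat x ⟨m - s - 1, by omega⟩ = x j' := by
      obtain ⟨u, hu⟩ := exists_orderStat_eq x j'
      have := card_orderStat_lt hx u
      rw [hu] at this
      rw [← hu]
      congr 1
      ext
      have hu2 := u.2
      have h2' : #{l | x j' < x l} = s := h2
      rw [h2'] at this
      change m - s - 1 = (u : ℕ)
      omega
    refine ⟨?_, ?_⟩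
    · rw [exceedance, e2]; exact h4
    · rw [precedence, e1]; exact h1

-- Multinomial probabilities

open Finset in
theorem prod_ite_mem_ite_mem {ι : Type*} [Fintype ι] [DecidableEq ι] {S T : Finset ι}
    (hST : Disjoint S T) (a b c : ℝ) :
    ∏ l, (if l ∈ S then a else if l ∈ T then b else c) =
      a ^ #S * b ^ #T * c ^ (Fintype.card ι - #S - #T) := by
  have h1 : ({l | l ∈ S} : Finset ι) = S := by ext; simp
  have h2 : ({l | l ∉ S} : Finset ι) = Sᶜ := by ext; simp
  have h3 : ({l ∈ Sᶜ | l ∈ T} : Finset ι) = T := by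
    ext l; simp only [mem_filter, mem_compl]
    exact ⟨fun h => h.2, fun h => ⟨fun h' => (disjoint_left.1 hST) h' h, h⟩⟩
  have h4 : ({l ∈ Sᶜ | l ∉ T} : Finset ι) = Sᶜ \ T := by ext l; simp
  have h5 : T ⊆ Sᶜ := fun l h => mem_compl.2 fun h' => (disjoint_left.1 hST) h' h
  rw [prod_ite, h1, h2, prod_ite, h3, h4]
  simp only [prod_const]
  rw [card_sdiff_of_subset h5, card_compl, mul_assoc]

open Finset in
/-- The multinomial probability that, among `N` independent observations with law `μ`, exactly `i`
satisfy `p` and exactly `s` satisfy `q`, for two incompatible properties. -/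
theorem pi_real_card_eq {N i s : ℕ} (μ : Measure ℝ) [IsProbabilityMeasure μ] {p q : ℝ → Prop}
    [DecidablePred p] [DecidablePred q] (hp : MeasurableSet {t | p t})
    (hq : MeasurableSet {t | q t}) (hpq : ∀ t, p t → ¬ q t) :
    (Measure.pi fun _ : Fin N => μ).real {x | #{l | p (x l)} = i ∧ #{l | q (x l)} = s} =
      N.choose i * (N - i).choose s * (μ.real {t | p t} ^ i * μ.real {t | q t} ^ s *
        (1 - μ.real {t | p t} - μ.real {t | q t}) ^ (N - i - s)) := by
  -- A configuration is the set `S` of indices satisfying `p` with the set `T` of those satisfying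
  -- `q`; incompatibility puts `T` in the complement of `S`. Each configuration is a box, and all
  -- boxes have the same measure.
  set I : Finset (Σ _ : Finset (Fin N), Finset (Fin N)) :=
    (powersetCard i univ).sigma fun S => powersetCard s Sᶜ with hI
  have hIcard : #I = N.choose i * (N - i).choose s := by
    rw [hI, card_sigma, sum_congr rfl (g := fun _ => (N - i).choose s)]
    · simp
    · intro S hS
      rw [card_powersetCard, card_compl, (mem_powersetCard.1 hS).2, Fintype.card_fin]
  set box : (Σ _ : Finset (Fin N), Finset (Fin N)) → Set (Fin N → ℝ) := fun a =>
    Set.univ.pi fun l => if l ∈ a.1 then {t | p t} else if l ∈ a.2 then {t | q t}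
      else ({t | p t} ∪ {t | q t})ᶜ with hbox
  have hmem : ∀ a ∈ I, ∀ x, x ∈ box a ↔
      (univ.filter fun l => p (x l)) = a.1 ∧ (univ.filter fun l => q (x l)) = a.2 := by
    rintro ⟨S, T⟩ ha x
    obtain ⟨-, hT⟩ := mem_sigma.1 ha
    have hT := (mem_powersetCard.1 hT).1
    simp only [hbox, Set.mem_pi, Set.mem_univ, true_implies, Finset.ext_iff, mem_filter, mem_univ,
      true_and]
    constructor
    · intro h
      constructor <;> intro l
      · have := h l
        split_ifs at this with h1 h2
        · exact ⟨fun _ => h1, fun _ => this⟩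
        · exact ⟨fun h' => absurd this (hpq _ h'), fun h' => absurd h' h1⟩
        · exact ⟨fun h' => absurd (Or.inl h') this, fun h' => absurd h' h1⟩
      · have := h l
        split_ifs at this with h1 h2
        · exact ⟨fun h' => absurd h' (hpq _ this), fun h' => absurd h1 (mem_compl.1 (hT h'))⟩
        · exact ⟨fun _ => h2, fun _ => this⟩
        · exact ⟨fun h' => absurd (Or.inr h') this, fun h' => absurd h' h2⟩
    · rintro ⟨h1, h2⟩ l
      split_ifs with h3 h4
      · exact (h1 l).2 h3
      · exact (h2 l).2 h4
      · rintro (h | h)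
        · exact h3 ((h1 l).1 h)
        · exact h4 ((h2 l).1 h)
  have hunion : {x : Fin N → ℝ | #{l | p (x l)} = i ∧ #{l | q (x l)} = s} = ⋃ a ∈ I, box a := by
    ext x
    simp only [Set.mem_iUnion]
    constructor
    · rintro ⟨h1, h2⟩
      have hm : (⟨univ.filter fun l => p (x l), univ.filter fun l => q (x l)⟩ :
          Σ _ : Finset (Fin N), Finset (Fin N)) ∈ I := by
        refine mem_sigma.2 ⟨mem_powersetCard.2 ⟨subset_univ _, h1⟩,
          mem_powersetCard.2 ⟨?_, h2⟩⟩
        intro l hl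
        simp only [mem_filter, mem_univ, true_and, mem_compl] at hl ⊢
        exact fun h => hpq _ h hl
      exact ⟨_, hm, (hmem _ hm x).2 ⟨rfl, rfl⟩⟩
    · rintro ⟨⟨S, T⟩, ha, hx⟩
      obtain ⟨h1, h2⟩ := (hmem _ ha x).1 hx
      obtain ⟨hS, hT⟩ := mem_sigma.1 ha
      exact ⟨by rw [h1]; exact (mem_powersetCard.1 hS).2,
        by rw [h2]; exact (mem_powersetCard.1 hT).2⟩
  have hdisj : (I : Set (Σ _ : Finset (Fin N), Finset (Fin N))).PairwiseDisjoint box := by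
    rintro ⟨S, T⟩ ha ⟨S', T'⟩ ha' hne
    refine Set.disjoint_left.2 fun x hx hx' => hne ?_
    obtain ⟨h1, h2⟩ := (hmem _ ha x).1 hx
    obtain ⟨h3, h4⟩ := (hmem _ ha' x).1 hx'
    simp only at h1 h2 h3 h4
    rw [← h1, ← h2, ← h3, ← h4]
  have hms : ∀ a, MeasurableSet (box a) := fun a => by
    refine MeasurableSet.univ_pi fun l => ?_
    split_ifs
    · exact hp
    · exact hq
    · exact (hp.union hq).compl
  have hcompl : μ.real ({t | p t} ∪ {t | q t})ᶜ = 1 - μ.real {t | p t} - μ.real {t | q t} := by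
    rw [probReal_compl_eq_one_sub (hp.union hq), measureReal_union _ hq, sub_sub]
    exact Set.disjoint_left.2 fun t h h' => hpq t h h'
  have hval : ∀ a ∈ I, (Measure.pi fun _ : Fin N => μ).real (box a) =
      μ.real {t | p t} ^ i * μ.real {t | q t} ^ s *
        (1 - μ.real {t | p t} - μ.real {t | q t}) ^ (N - i - s) := by
    rintro ⟨S, T⟩ ha
    obtain ⟨hS, hT⟩ := mem_sigma.1 ha
    have hd : Disjoint S T :=
      disjoint_left.2 fun l h h' => mem_compl.1 ((mem_powersetCard.1 hT).1 h') h
    have := prod_ite_mem_ite_mem hd (μ.real {t | p t}) (μ.real {t | q t})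
      (μ.real ({t | p t} ∪ {t | q t})ᶜ)
    rw [(mem_powersetCard.1 hS).2, (mem_powersetCard.1 hT).2, hcompl, Fintype.card_fin] at this
    rw [← this, hbox, measureReal_def, Measure.pi_pi, ENNReal.toReal_prod]
    refine prod_congr rfl fun l _ => ?_
    split_ifs
    · rfl
    · rfl
    · rw [← measureReal_def, hcompl]
  rw [hunion, measureReal_biUnion_finset hdisj fun a _ => hms a, sum_congr rfl hval, sum_const,
    hIcard]
  simp

-- Integrating over the distinguished pair

theorem measureReal_prod_eq_integral {α β : Type*} [MeasurableSpace α] [MeasurableSpace β]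
    (ρ : Measure α) [IsProbabilityMeasure ρ] (κ : Measure β) [IsProbabilityMeasure κ]
    {S : Set (α × β)} (hS : MeasurableSet S) :
    (ρ.prod κ).real S = ∫ a, κ.real (Prod.mk a ⁻¹' S) ∂ρ := by
  rw [measureReal_def, Measure.prod_apply hS, ← integral_toReal]
  · rfl
  · exact (measurable_measure_prodMk_left hS).aemeasurable
  · exact Filter.Eventually.of_forall fun a => measure_lt_top _ _

theorem integrable_measureReal_prodMk {α β : Type*} [MeasurableSpace α] [MeasurableSpace β]
    (ρ : Measure α) [IsProbabilityMeasure ρ] (κ : Measure β) [IsProbabilityMeasure κ]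
    {S : Set (α × β)} (hS : MeasurableSet S) :
    Integrable (fun a => κ.real (Prod.mk a ⁻¹' S)) ρ := by
  refine Integrable.of_bound (C := 1)
    (measurable_measure_prodMk_left hS).ennreal_toReal.aestronglyMeasurable ?_
  refine Filter.Eventually.of_forall fun a => ?_
  change ‖κ.real _‖ ≤ 1
  rw [Real.norm_of_nonneg measureReal_nonneg]
  exact measureReal_le_one

/-- Assemble two samples from a distinguished observation of each and the remaining ones. -/
def insertPair {M N : ℕ} (p : Fin (M + 1) × Fin (N + 1))
    (w : (ℝ × ℝ) × ((Fin M → ℝ) × (Fin N → ℝ))) : Fin (M + 1) ⊕ Fin (N + 1) → ℝ :=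
  Sum.elim (p.1.insertNth (α := fun _ => ℝ) w.1.1 w.2.1)
    (p.2.insertNth (α := fun _ => ℝ) w.1.2 w.2.2)

theorem measurePreserving_insertPair {M N : ℕ} (p : Fin (M + 1) × Fin (N + 1)) (μ ν : Measure ℝ)
    [IsProbabilityMeasure μ] [IsProbabilityMeasure ν] (κ : Fin (M + 1) ⊕ Fin (N + 1) → Measure ℝ)
    [∀ l, IsProbabilityMeasure (κ l)] (hκ : κ = Sum.elim (fun _ => μ) (fun _ => ν)) :
    MeasurePreserving (insertPair p)
      ((μ.prod ν).prod ((Measure.pi fun _ : Fin M => μ).prod (Measure.pi fun _ : Fin N => ν)))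
      (Measure.pi κ) := by
  have hmeas : Measurable (insertPair (M := M) (N := N) p) := by
    refine measurable_pi_lambda _ ?_
    rintro (l | l)
    · refine Fin.succAboveCases p.1 ?_ (fun t => ?_) l
      · simpa [insertPair] using! measurable_fst.comp measurable_fst
      · simpa [insertPair] using!
          (measurable_pi_apply t).comp (measurable_fst.comp measurable_snd)
    · refine Fin.succAboveCases p.2 ?_ (fun t => ?_) l
      · simpa [insertPair] using! measurable_snd.comp measurable_fst
      · simpa [insertPair] using!
          (measurable_pi_apply t).comp (measurable_snd.comp measurable_snd)
  refine ⟨hmeas, (Measure.pi_eq fun S hS => ?_).symm⟩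
  rw [Measure.map_apply hmeas (MeasurableSet.univ_pi hS)]
  have hpre : insertPair p ⁻¹' Set.univ.pi S =
      (S (.inl p.1) ×ˢ S (.inr p.2)) ×ˢ
        ((Set.univ.pi fun l => S (.inl (p.1.succAbove l))) ×ˢ
          (Set.univ.pi fun l => S (.inr (p.2.succAbove l)))) := by
    ext w
    simp only [insertPair, Set.mem_preimage, Set.mem_pi, Set.mem_univ, true_implies, Sum.forall,
      Sum.elim_inl, Sum.elim_inr, Set.mem_prod, Fin.forall_iff_succAbove p.1,
      Fin.forall_iff_succAbove p.2, Fin.insertNth_apply_same, Fin.insertNth_apply_succAbove]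
    tauto
  rw [hpre, Measure.prod_prod, Measure.prod_prod, Measure.prod_prod, Measure.pi_pi, Measure.pi_pi,
    Fintype.prod_sum_type, Fin.prod_univ_succAbove _ p.1, Fin.prod_univ_succAbove _ p.2, hκ]
  simp only [Sum.elim_inl, Sum.elim_inr]
  ring

open Finset in
theorem card_filter_insertNth {M : ℕ} (j : Fin (M + 1)) (u : ℝ) (x : Fin M → ℝ) (p : ℝ → Prop)
    [DecidablePred p] (hu : ¬ p u) :
    #{l | p (j.insertNth (α := fun _ => ℝ) u x l)} = #{l | p (x l)} := by
  rw [card_filter, card_filter, Fin.sum_univ_succAbove _ j]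
  simp [hu]

-- By Fubini the pair `(u, v)` is fixed first. When `u < v` neither distinguished observation enters
-- any of the four counts, so these concern only the remaining `M` and `N` observations, which are
-- independent. The value does not depend on `p`.
open Finset in
theorem pi_real_extremePairEvent {M N i k s r : ℕ} (p : Fin (M + 1) × Fin (N + 1))
    (μ ν : Measure ℝ) [IsProbabilityMeasure μ] [IsProbabilityMeasure ν]
    (κ : Fin (M + 1) ⊕ Fin (N + 1) → Measure ℝ)
    [∀ l, IsProbabilityMeasure (κ l)] (hκ : κ = Sum.elim (fun _ => μ) (fun _ => ν)) :
    (Measure.pi κ).real (extremePairEvent (M + 1) (N + 1) i k s r p) =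
      (M.choose i * (M - i).choose s) * (N.choose r * (N - r).choose k) *
      ∫ v, ∫ u, (if u < v then
        μ.real (Set.Ioi v) ^ i * μ.real (Set.Iio u) ^ s *
          (1 - μ.real (Set.Ioi v) - μ.real (Set.Iio u)) ^ (M - i - s) *
        (ν.real (Set.Ioi v) ^ r * ν.real (Set.Iio u) ^ k *
          (1 - ν.real (Set.Ioi v) - ν.real (Set.Iio u)) ^ (N - r - k)) else 0) ∂μ ∂ν := by
  have hmp := measurePreserving_insertPair p μ ν κ hκ
  have hE := measurableSet_extremePairEvent (M + 1) (N + 1) i k s r p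
  have hS := hmp.measurable hE
  set S := insertPair p ⁻¹' extremePairEvent (M + 1) (N + 1) i k s r p with hSdef
  set Q := (Measure.pi fun _ : Fin M => μ).prod (Measure.pi fun _ : Fin N => ν) with hQ
  have hsec : ∀ w : ℝ × ℝ, Q.real (Prod.mk w ⁻¹' S) =
      (M.choose i * (M - i).choose s) * (N.choose r * (N - r).choose k) *
      (if w.1 < w.2 then
        μ.real (Set.Ioi w.2) ^ i * μ.real (Set.Iio w.1) ^ s *
          (1 - μ.real (Set.Ioi w.2) - μ.real (Set.Iio w.1)) ^ (M - i - s) *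
        (ν.real (Set.Ioi w.2) ^ r * ν.real (Set.Iio w.1) ^ k *
          (1 - ν.real (Set.Ioi w.2) - ν.real (Set.Iio w.1)) ^ (N - r - k)) else 0) := by
    rintro ⟨u, v⟩
    simp only
    split_ifs with huv
    · have : Prod.mk (u, v) ⁻¹' S =
          {x : Fin M → ℝ | #{l | v < x l} = i ∧ #{l | x l < u} = s} ×ˢ
          {y : Fin N → ℝ | #{l | v < y l} = r ∧ #{l | y l < u} = k} := by
        ext ⟨x, y⟩
        simp only [hSdef, Set.mem_preimage, extremePairEvent, insertPair, Sum.elim_inl,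
          Sum.elim_inr, Set.mem_ofPred_eq, Set.mem_prod, Fin.insertNth_apply_same, huv, true_and]
        rw [card_filter_insertNth p.1 u x (fun t => v < t) huv.not_gt,
          card_filter_insertNth p.1 u x (fun t => t < u) (lt_irrefl u),
          card_filter_insertNth p.2 v y (fun t => v < t) (lt_irrefl v),
          card_filter_insertNth p.2 v y (fun t => t < u) huv.not_gt]
      have hpq : ∀ t : ℝ, v < t → ¬ t < u := fun t h1 h2 => absurd (h1.trans h2) huv.not_gt
      have h1 := pi_real_card_eq (N := M) (i := i) (s := s) μ (p := fun t => v < t)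
        (q := fun t => t < u) measurableSet_Ioi measurableSet_Iio hpq
      have h2 := pi_real_card_eq (N := N) (i := r) (s := k) ν (p := fun t => v < t)
        (q := fun t => t < u) measurableSet_Ioi measurableSet_Iio hpq
      rw [this, hQ, measureReal_prod_prod, h1, h2]
      change _ * (μ.real (Set.Ioi v) ^ i * μ.real (Set.Iio u) ^ s *
        (1 - μ.real (Set.Ioi v) - μ.real (Set.Iio u)) ^ (M - i - s)) *
        (_ * (ν.real (Set.Ioi v) ^ r * ν.real (Set.Iio u) ^ k *
        (1 - ν.real (Set.Ioi v) - ν.real (Set.Iio u)) ^ (N - r - k))) = _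
      ring
    · have : Prod.mk (u, v) ⁻¹' S = ∅ := by
        ext ⟨x, y⟩
        simp only [hSdef, Set.mem_preimage, extremePairEvent, insertPair, Sum.elim_inl,
          Sum.elim_inr, Set.mem_ofPred_eq, Fin.insertNth_apply_same, huv, false_and,
          Set.mem_empty_iff_false]
      rw [this]; simp
  have hint := integrable_measureReal_prodMk (μ.prod ν) Q hS
  rw [← hmp.measureReal_preimage hE.nullMeasurableSet, ← hSdef,
    measureReal_prod_eq_integral (μ.prod ν) Q hS, integral_prod_symm _ hint]
  simp only [hsec, integral_const_mul]

-- Beta integrals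

theorem integral_powerLaw {a : ℝ} (ha : 0 < a) (f : ℝ → ℝ) :
    ∫ v, f v ∂(powerLaw a) = ∫ v in (0 : ℝ)..1, a * v ^ (a - 1) * f v := by
  rw [powerLaw, integral_withDensity_eq_integral_toReal_smul (by fun_prop)
    (Filter.Eventually.of_forall fun _ => ENNReal.ofReal_lt_top),
    intervalIntegral.integral_of_le zero_le_one, integral_Ioc_eq_integral_Ioo]
  refine setIntegral_congr_fun measurableSet_Ioo fun v hv => ?_
  have : 0 ≤ a * v ^ (a - 1) := mul_nonneg ha.le (Real.rpow_nonneg hv.1.le _)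
  simp only [ENNReal.toReal_ofReal this, smul_eq_mul]

theorem integral_powerLaw_one_ite_lt {v : ℝ} (h0 : 0 ≤ v) (h1 : v ≤ 1) (f : ℝ → ℝ) :
    ∫ u, (if u < v then f u else 0) ∂(powerLaw 1) = ∫ u in (0 : ℝ)..v, f u := by
  rw [integral_powerLaw one_pos, intervalIntegral.integral_of_le zero_le_one,
    intervalIntegral.integral_of_le h0, integral_Ioc_eq_integral_Ioo (y := v)]
  have hsub : Set.Ioo 0 v ⊆ Set.Ioc 0 1 := fun u hu => ⟨hu.1, hu.2.le.trans h1⟩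
  have h : ∀ u ∈ Set.Ioc (0 : ℝ) 1, 1 * u ^ ((1 : ℝ) - 1) * (if u < v then f u else 0) =
      (Set.Ioo 0 v).indicator f u := by
    intro u hu
    by_cases huv : u < v
    · rw [Set.indicator_of_mem (show u ∈ Set.Ioo 0 v from ⟨hu.1, huv⟩)]; simp [huv]
    · rw [Set.indicator_of_notMem (fun h => huv h.2)]; simp [huv]
  rw [setIntegral_congr_fun measurableSet_Ioc h, setIntegral_indicator measurableSet_Ioo,
    Set.inter_eq_self_of_subset_right hsub]

-- Euler's Beta integral with parameters `c` and `N + 1`.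
open scoped Nat in
theorem integral_rpow_mul_one_sub_pow {c : ℝ} (hc : 0 < c) (N : ℕ) :
    ∫ t in (0 : ℝ)..1, t ^ (c - 1) * (1 - t) ^ N =
      (N ! : ℝ) * (Real.Gamma c / Real.Gamma (c + N + 1)) := by
  have hN : (0 : ℝ) < N + 1 := by positivity
  have h1 := beta_eq_betaIntegralReal c (N + 1) hc hN
  have h2 : Complex.betaIntegral (c : ℂ) ((N + 1 : ℝ) : ℂ) =
      ((∫ t in (0 : ℝ)..1, t ^ (c - 1) * (1 - t) ^ N : ℝ) : ℂ) := by
    rw [← intervalIntegral.integral_ofReal, Complex.betaIntegral]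
    refine intervalIntegral.integral_congr fun t ht => ?_
    rw [Set.uIcc_of_le zero_le_one] at ht
    have : ((N + 1 : ℝ) : ℂ) - 1 = (N : ℂ) := by push_cast; ring
    simp only [this, Complex.cpow_natCast]
    push_cast
    rw [Complex.ofReal_cpow ht.1]
    push_cast; rfl
  rw [h2, Complex.ofReal_re] at h1
  rw [← h1, beta, Real.Gamma_nat_eq_factorial, add_assoc]
  ring

theorem intervalIntegrable_rpow_mul_one_sub_pow {c : ℝ} (hc : 0 < c) (N : ℕ) :
    IntervalIntegrable (fun t : ℝ => t ^ (c - 1) * (1 - t) ^ N) volume 0 1 :=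
  (intervalIntegral.intervalIntegrable_rpow' (by linarith)).mul_continuousOn (by fun_prop)

-- Expanding `(1 - t ^ a) ^ e` by the binomial theorem leaves one Beta integral per term, with `c`
-- shifted by `a * z`.
open scoped Nat in
theorem integral_rpow_mul_one_sub_pow_mul_one_sub_rpow_pow {a c : ℝ} (ha : 0 < a) (hc : 0 < c)
    (N e : ℕ) :
    ∫ t in (0 : ℝ)..1, t ^ (c - 1) * (1 - t) ^ N * (1 - t ^ a) ^ e =
      (N ! : ℝ) * ∑ z ∈ Finset.range (e + 1), (-1 : ℝ) ^ z * (e.choose z : ℝ) *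
        (Real.Gamma (c + a * z) / Real.Gamma (c + a * z + N + 1)) := by
  have hcz : ∀ z : ℕ, 0 < c + a * z := fun z => by positivity
  have hexp : Set.EqOn (fun t : ℝ => t ^ (c - 1) * (1 - t) ^ N * (1 - t ^ a) ^ e)
      (fun t => ∑ z ∈ Finset.range (e + 1), ((-1 : ℝ) ^ z * (e.choose z : ℝ)) *
        (t ^ (c + a * z - 1) * (1 - t) ^ N)) (Set.Ioc 0 1) := by
    intro t ht
    have hb : (1 - t ^ a) ^ e =
        ∑ z ∈ Finset.range (e + 1), (-1 : ℝ) ^ z * (e.choose z : ℝ) * t ^ (a * z) := by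
      rw [sub_eq_neg_add, add_pow]
      refine Finset.sum_congr rfl fun z _ => ?_
      rw [neg_pow, Real.rpow_mul ht.1.le, Real.rpow_natCast]
      ring
    simp only [hb, Finset.mul_sum]
    refine Finset.sum_congr rfl fun z _ => ?_
    rw [show c + a * z - 1 = (c - 1) + a * z by ring, Real.rpow_add ht.1]
    ring
  rw [intervalIntegral.integral_of_le zero_le_one, setIntegral_congr_fun measurableSet_Ioc hexp,
    ← intervalIntegral.integral_of_le zero_le_one, intervalIntegral.integral_finsetSum
      fun z _ => (intervalIntegrable_rpow_mul_one_sub_pow (hcz z) N).const_mul _, Finset.mul_sum]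
  refine Finset.sum_congr rfl fun z _ => ?_
  rw [intervalIntegral.integral_const_mul, integral_rpow_mul_one_sub_pow (hcz z)]
  ring

/-- The substitution `u = v t`: every factor of the integrand is homogeneous in `(u, v)`, so all
powers of `v` come out. -/
theorem integral_zero_to_eq_mul_integral_one {a v : ℝ} (h0 : 0 < v) (s d k e : ℕ) :
    ∫ u in (0 : ℝ)..v, u ^ s * (v - u) ^ d * ((u ^ a) ^ k * (v ^ a - u ^ a) ^ e) =
      v ^ (s + d + 1) * (v ^ a) ^ (k + e) *
        ∫ t in (0 : ℝ)..1, t ^ ((s + 1 + a * k : ℝ) - 1) * (1 - t) ^ d * (1 - t ^ a) ^ e := by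
  have h := intervalIntegral.mul_integral_comp_mul_left (a := 0) (b := 1)
    (f := fun u : ℝ => u ^ s * (v - u) ^ d * ((u ^ a) ^ k * (v ^ a - u ^ a) ^ e)) (c := v)
  rw [mul_zero, mul_one] at h
  rw [← h, ← intervalIntegral.integral_const_mul, ← intervalIntegral.integral_const_mul,
    intervalIntegral.integral_of_le zero_le_one, intervalIntegral.integral_of_le zero_le_one]
  refine setIntegral_congr_fun measurableSet_Ioc fun t ht => ?_
  have h1 : t ^ ((s + 1 + a * k : ℝ) - 1) = t ^ s * (t ^ a) ^ k := by
    rw [show (s + 1 + a * k : ℝ) - 1 = s + a * k by ring, Real.rpow_add ht.1, Real.rpow_natCast,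
      Real.rpow_mul ht.1.le, Real.rpow_natCast]
  simp only [h1, Real.mul_rpow h0.le ht.1.le]
  rw [show v - v * t = v * (1 - t) by ring,
    show v ^ a - v ^ a * t ^ a = v ^ a * (1 - t ^ a) by ring]
  simp only [mul_pow]
  ring

/-- The double integral over `0 < u < v < 1` factorizes after the substitution `u = v t`. -/
theorem integral_integral_powerLaw {a : ℝ} (ha : 0 < a) (i s d r k e : ℕ) :
    ∫ v, ∫ u, (if u < v then
        (powerLaw 1).real (Set.Ioi v) ^ i * (powerLaw 1).real (Set.Iio u) ^ s *
          (1 - (powerLaw 1).real (Set.Ioi v) - (powerLaw 1).real (Set.Iio u)) ^ d *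
        ((powerLaw a).real (Set.Ioi v) ^ r * (powerLaw a).real (Set.Iio u) ^ k *
          (1 - (powerLaw a).real (Set.Ioi v) - (powerLaw a).real (Set.Iio u)) ^ e) else 0)
        ∂(powerLaw 1) ∂(powerLaw a) =
      a * (∫ v in (0 : ℝ)..1, v ^ ((s + d + 1 + a * (k + e + 1) : ℝ) - 1) * (1 - v) ^ i *
          (1 - v ^ a) ^ r) *
        ∫ t in (0 : ℝ)..1, t ^ ((s + 1 + a * k : ℝ) - 1) * (1 - t) ^ d * (1 - t ^ a) ^ e := by
  generalize hJ : (∫ t in (0 : ℝ)..1, t ^ ((s + 1 + a * k : ℝ) - 1) * (1 - t) ^ d *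
    (1 - t ^ a) ^ e) = J
  rw [integral_powerLaw ha, ← intervalIntegral.integral_const_mul,
    ← intervalIntegral.integral_mul_const, intervalIntegral.integral_of_le zero_le_one,
    intervalIntegral.integral_of_le zero_le_one]
  refine setIntegral_congr_fun measurableSet_Ioc fun v hv => ?_
  have hinner : (∫ u, (if u < v then
        (powerLaw 1).real (Set.Ioi v) ^ i * (powerLaw 1).real (Set.Iio u) ^ s *
          (1 - (powerLaw 1).real (Set.Ioi v) - (powerLaw 1).real (Set.Iio u)) ^ d *
        ((powerLaw a).real (Set.Ioi v) ^ r * (powerLaw a).real (Set.Iio u) ^ k *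
          (1 - (powerLaw a).real (Set.Ioi v) - (powerLaw a).real (Set.Iio u)) ^ e) else 0)
        ∂(powerLaw 1)) = (1 - v) ^ i * (1 - v ^ a) ^ r *
          ∫ u in (0 : ℝ)..v, u ^ s * (v - u) ^ d * ((u ^ a) ^ k * (v ^ a - u ^ a) ^ e) := by
    rw [integral_powerLaw_one_ite_lt hv.1.le hv.2, ← intervalIntegral.integral_const_mul,
      intervalIntegral.integral_of_le hv.1.le, intervalIntegral.integral_of_le hv.1.le]
    refine setIntegral_congr_fun measurableSet_Ioc fun u hu => ?_
    have hu1 : u ≤ 1 := hu.2.trans hv.2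
    simp only [powerLaw_real_Ioi one_pos hv.1.le hv.2, powerLaw_real_Ioi ha hv.1.le hv.2,
      powerLaw_real_Iio one_pos hu.1.le hu1, powerLaw_real_Iio ha hu.1.le hu1, Real.rpow_one]
    rw [show 1 - (1 - v) - u = v - u by ring, show 1 - (1 - v ^ a) - u ^ a = v ^ a - u ^ a by ring]
    ring
  simp only [hinner, integral_zero_to_eq_mul_integral_one hv.1, hJ]
  -- The powers of `v` released by the substitution merge with the density `a * v ^ (a - 1)`.
  have hpow : v ^ ((s + d + 1 + a * (k + e + 1) : ℝ) - 1) =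
      v ^ (s + d + 1) * (v ^ a) ^ (k + e) * v ^ (a - 1) := by
    rw [← Real.rpow_natCast, ← Real.rpow_natCast, ← Real.rpow_mul hv.1.le, ← Real.rpow_add hv.1,
      ← Real.rpow_add hv.1]
    congr 1; push_cast; ring
  rw [hpow]
  ring

open scoped Nat in
theorem choose_mul_choose_eq (a b c : ℕ) :
    ((a + b + c).choose a : ℝ) * (b + c).choose b = (a + b + c)! / (a ! * b ! * c !) := by
  have hne : ∀ t : ℕ, (t ! : ℝ) ≠ 0 := fun t => by exact_mod_cast t.factorial_ne_zero
  rw [add_assoc, Nat.cast_add_choose, Nat.cast_add_choose]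
  have := hne a
  have := hne b
  have := hne c
  have := hne (b + c)
  field_simp

-- Joint law of the two counts and distribution of the statistic

section
variable {Ω : Type*} [MeasurableSpace Ω] {P : Measure Ω} {m n : ℕ} {η : ℝ}
  {F : ℝ → ℝ} {X : Fin m → Ω → ℝ} {Y : Fin n → Ω → ℝ}

theorem IsLehmannTwoSample.measurable_transform (h : IsLehmannTwoSample P η F X Y) :
    Measurable (fun ω l => 1 - F (Sum.elim X Y l ω)) := by
  refine measurable_pi_lambda _ fun l => measurable_const.sub (h.continuous_F.measurable.comp ?_)
  rcases l with j | j
  · exact h.measurable_X j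
  · exact h.measurable_Y j

theorem IsLehmannTwoSample.measurable_sidakStat (h : IsLehmannTwoSample P η F X Y) {ρ : ℝ}
    (hρ : ρ < 1) (hm : 0 < m) (hn : 0 < n) :
    Measurable fun ω => sidakStat ρ hρ hm hn (fun j => X j ω) (fun j => Y j ω) :=
  (measurable_exceedance h.measurable_X h.measurable_Y _).add
    (measurable_precedence h.measurable_X h.measurable_Y _)

variable [IsProbabilityMeasure P]

theorem IsLehmannTwoSample.ae_injective_transform (hη : 0 < η) (hm : 0 < m)
    (h : IsLehmannTwoSample P η F X Y) :
    ∀ᵐ ω ∂P, Function.Injective fun l => 1 - F (Sum.elim X Y l ω) := by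
  have := fun l => isProbabilityMeasure_lehmannLaw (m := m) (n := n) hη l
  have : ∀ l, NullSingletonClass (lehmannLaw m n η l) := by
    rintro (l | l) <;> exact nullSingletonClass_powerLaw _
  have h1 := ae_pi_injective (lehmannLaw m n η)
  rw [← h.map_eq_pi hη hm] at h1
  exact ae_of_ae_map h.measurable_transform.aemeasurable h1

theorem IsLehmannTwoSample.ae_injective (hη : 0 < η) (hm : 0 < m)
    (h : IsLehmannTwoSample P η F X Y) :
    ∀ᵐ ω ∂P, Function.Injective (Sum.elim (fun j => X j ω) (fun j => Y j ω)) := by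
  filter_upwards [h.ae_injective_transform hη hm] with ω hω l l' hl
  refine hω ?_
  have e : ∀ l, Sum.elim X Y l ω = Sum.elim (fun j => X j ω) (fun j => Y j ω) l := by
    rintro (l | l) <;> rfl
  simp only [e, hl]

open scoped Nat in
/-- The joint probability on the event `Y_{(1+r)} < X_{(m-s)}`. -/
theorem IsLehmannTwoSample.real_exceedance_precedence_eq (hη : 0 < η)
    (h : IsLehmannTwoSample P η F X Y) {s r k i : ℕ} (hs : s < m) (hr : r < n)
    (hi : i ≤ m - s - 1) (hk : k ≤ n - r - 1) :
    P.real {ω | exceedance s hs (fun j => X j ω) (fun j => Y j ω) = k ∧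
        precedence r hr (fun j => X j ω) (fun j => Y j ω) = i} =
      ((m ! : ℝ) * (n ! : ℝ) * (1 / η)) /
        ((r ! : ℝ) * (s ! : ℝ) * ((n - k - r - 1)! : ℝ) * (k ! : ℝ)) *
      lehmannSp m n r η i * lehmannSz m n s r η k i := by
  have hm : 0 < m := by omega
  have ha : 0 < 1 / η := one_div_pos.2 hη
  have := isProbabilityMeasure_powerLaw one_pos
  have := isProbabilityMeasure_powerLaw ha
  have := fun l => isProbabilityMeasure_lehmannLaw (m := m) (n := n) hη l
  obtain ⟨hmono, -, -⟩ := isCDF_of_real_le (h.measurable_X ⟨0, hm⟩) (h.cdf_X ⟨0, hm⟩)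
  set T : Ω → Fin m ⊕ Fin n → ℝ := fun ω l => 1 - F (Sum.elim X Y l ω) with hT
  have hTm : Measurable T := h.measurable_transform
  have hE := measurableSet_extremePairEvent m n i k s r
  have hset : {ω | exceedance s hs (fun j => X j ω) (fun j => Y j ω) = k ∧
        precedence r hr (fun j => X j ω) (fun j => Y j ω) = i} =ᵐ[P]
      ⋃ p, T ⁻¹' extremePairEvent m n i k s r p := by
    filter_upwards [h.ae_injective_transform hη hm, h.ae_injective hη hm] with ω hω hω'
    refine propext ?_
    have e : ∀ l, Sum.elim (fun j => X j ω) (fun j => Y j ω) l = Sum.elim X Y l ω := by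
      rintro (l | l) <;> rfl
    have key := exceedance_precedence_iff (k := k) (z := T ω) hs hr hi hω' ?_
    · change (_ ∧ _) ↔ ω ∈ ⋃ p, T ⁻¹' extremePairEvent m n i k s r p
      simpa only [Set.mem_iUnion, Set.mem_preimage] using key
    -- `F` is only weakly increasing; strictness comes from the absence of ties among the
    -- transformed values.
    · intro l l'
      rw [e, e]
      constructor
      · intro hlt
        refine lt_of_le_of_ne (sub_le_sub_left (hmono hlt.le) _) fun heq => ?_
        rw [hω heq] at hlt
        exact lt_irrefl _ hlt
      · intro hlt
        by_contra hle
        exact absurd (sub_le_sub_left (hmono (not_lt.1 hle)) 1) (not_le.2 hlt)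
  have hdisj : Pairwise (Function.onFun (AEDisjoint P)
      fun p => T ⁻¹' extremePairEvent m n i k s r p) := by
    intro p q hpq
    refine measure_mono_null ?_ (ae_iff.1 (h.ae_injective_transform hη hm))
    rintro ω ⟨h1, h2⟩ hω
    exact hpq (extremePairEvent_unique hω h1 h2)
  have hsum : P.real (⋃ p, T ⁻¹' extremePairEvent m n i k s r p) =
      ∑ p, (Measure.pi (lehmannLaw m n η)).real (extremePairEvent m n i k s r p) := by
    rw [measureReal_def, measure_iUnion₀ hdisj fun p => (hTm (hE p)).nullMeasurableSet,
      tsum_fintype, ENNReal.toReal_sum fun p _ => measure_ne_top _ _]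
    refine Finset.sum_congr rfl fun p _ => ?_
    rw [← h.map_eq_pi hη hm, map_measureReal_apply hTm (hE p), measureReal_def]
  rw [measureReal_congr hset, hsum]
  obtain ⟨M, rfl⟩ : ∃ M, m = M + 1 := ⟨m - 1, by omega⟩
  obtain ⟨N, rfl⟩ : ∃ N, n = N + 1 := ⟨n - 1, by omega⟩
  -- `d` and `e` count the `X`'s and `Y`'s lying strictly between the distinguished pair. Writing
  -- the sizes as sums removes the truncated subtractions.
  obtain ⟨d, rfl⟩ : ∃ d, M = i + s + d := ⟨M - i - s, by omega⟩
  obtain ⟨e, rfl⟩ : ∃ e, N = r + k + e := ⟨N - r - k, by omega⟩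
  have hval := fun p => pi_real_extremePairEvent (i := i) (k := k) (s := s) (r := r)
    (M := i + s + d) (N := r + k + e) p (powerLaw 1) (powerLaw (1 / η)) (lehmannLaw _ _ η) rfl
  -- All pairs contribute equally; their number `m * n` turns the factorials of `m - 1` and `n - 1`
  -- in the multinomial coefficients into those of `m` and `n`.
  simp only [hval,
    integral_integral_powerLaw ha, Finset.sum_const, Finset.card_univ, Fintype.card_prod,
    Fintype.card_fin, nsmul_eq_mul]
  rw [show i + s + d - i - s = d by omega, show r + k + e - r - k = e by omega,
    show r + k + e + 1 - k - r - 1 = e by omega, show i + s + d - i = s + d by omega,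
    show r + k + e - r = k + e by omega,
    integral_rpow_mul_one_sub_pow_mul_one_sub_rpow_pow ha (by positivity),
    integral_rpow_mul_one_sub_pow_mul_one_sub_rpow_pow ha (by positivity)]
  have hSp : (∑ z ∈ Finset.range (r + 1), (-1 : ℝ) ^ z * (r.choose z : ℝ) *
      (Real.Gamma (s + d + 1 + 1 / η * (k + e + 1) + 1 / η * z) /
        Real.Gamma (s + d + 1 + 1 / η * (k + e + 1) + 1 / η * z + i + 1))) =
      lehmannSp (i + s + d + 1) (r + k + e + 1) r η i := by
    refine Finset.sum_congr rfl fun z _ => ?_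
    congr 3 <;> push_cast <;> ring
  have hSz : (∑ z ∈ Finset.range (e + 1), (-1 : ℝ) ^ z * (e.choose z : ℝ) *
      (Real.Gamma (s + 1 + 1 / η * k + 1 / η * z) /
        Real.Gamma (s + 1 + 1 / η * k + 1 / η * z + d + 1))) =
      lehmannSz (i + s + d + 1) (r + k + e + 1) s r η k i := by
    rw [lehmannSz, show r + k + e + 1 - k - r - 1 = e by omega]
    refine Finset.sum_congr rfl fun z _ => ?_
    congr 3 <;> push_cast <;> ring
  rw [hSp, hSz]
  have hM : ((i + s + d + 1)! : ℝ) = (i + s + d + 1) * (i + s + d)! := by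
    rw [Nat.factorial_succ]; push_cast; ring
  have hN : ((r + k + e + 1)! : ℝ) = (r + k + e + 1) * (r + k + e)! := by
    rw [Nat.factorial_succ]; push_cast; ring
  have hne : ∀ t : ℕ, (t ! : ℝ) ≠ 0 := fun t => by exact_mod_cast t.factorial_ne_zero
  rw [choose_mul_choose_eq, choose_mul_choose_eq, hM, hN]
  have hi := hne i
  have hs := hne s
  have hd := hne d
  have hr := hne r
  have hk := hne k
  have he := hne e
  push_cast
  clear * - hi hs hd hr hk he
  generalize lehmannSp _ _ _ _ _ = Sp
  generalize lehmannSz _ _ _ _ _ _ _ = Sz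
  field_simp

/-- The joint probability mass function of `(A_s, B_r)`. -/
theorem IsLehmannTwoSample.real_exceedance_precedence (hη : 0 < η)
    (h : IsLehmannTwoSample P η F X Y) {s r : ℕ} (hs : s < m) (hr : r < n) (k i : ℕ) :
    P.real {ω | exceedance s hs (fun j => X j ω) (fun j => Y j ω) = k ∧
        precedence r hr (fun j => X j ω) (fun j => Y j ω) = i} = lehmannPmf m n s r η k i := by
  have hm : 0 < m := by omega
  have hae : ∀ᵐ ω ∂P, Function.Injective (fun j => X j ω) ∧ Function.Injective (fun j => Y j ω) ∧
      ∀ i j, X i ω ≠ Y j ω := by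
    filter_upwards [h.ae_injective hη hm] with ω hω
    refine ⟨hω.comp Sum.inl_injective, hω.comp Sum.inr_injective, fun i j hij => ?_⟩
    exact Sum.inl_ne_inr (hω (a₁ := .inl i) (a₂ := .inr j) hij)
  rw [lehmannPmf]
  split_ifs with h1 h2
  · exact h.real_exceedance_precedence_eq hη hs hr h1.1 h1.2
  -- In this region `X_{(m-s)} < Y_{(1+r)}`, so the first formula applies to the exchanged samples.
  -- Off ties the new counts are the complements `m - i` and `n - k`, and the roles of the two sums
  -- are interchanged.
  · have hsw := (h.swap hη hm).real_exceedance_precedence_eq (one_div_pos.2 hη) (s := n - r - 1)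
      (r := m - s - 1) (k := m - i) (i := n - k) (by omega) (by omega) (by omega) (by omega)
    have hset : {ω | exceedance s hs (fun j => X j ω) (fun j => Y j ω) = k ∧
        precedence r hr (fun j => X j ω) (fun j => Y j ω) = i} =ᵐ[P]
        {ω | exceedance (n - r - 1) (by omega) (fun j => Y j ω) (fun j => X j ω) = m - i ∧
        precedence (m - s - 1) (by omega) (fun j => Y j ω) (fun j => X j ω) = n - k} := by
      filter_upwards [hae] with ω hω
      refine propext ?_
      change (_ ∧ _) ↔ (_ ∧ _)
      have e1 := precedence_swap_add hs hω.2.2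
      have e2 := precedence_add_exceedance_swap hr hω.2.2
      omega
    rw [measureReal_congr hset, hsw]
    have hSp : lehmannSp n m (m - s - 1) (1 / η) (n - k) = lehmannSz' m n s η k := by
      refine Finset.sum_congr rfl fun z _ => ?_
      have : s + 1 ≤ m := hs
      rw [Nat.cast_sub h2.2.2, Nat.sub_sub, Nat.cast_sub this, div_div_eq_mul_div, div_one]
      congr 3 <;> push_cast <;> ring
    have hSz : lehmannSz n m (n - r - 1) (m - s - 1) (1 / η) (m - i) (n - k) =
        lehmannSp' m n s r η k i := by
      have e : m - (m - i) - (m - s - 1) - 1 = i + s - m := by omega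
      rw [lehmannSz, lehmannSp', e]
      refine Finset.sum_congr rfl fun z _ => ?_
      have : r + 1 ≤ n := hr
      rw [Nat.cast_sub h2.2.2, Nat.sub_sub, Nat.cast_sub this, div_div_eq_mul_div, div_one,
        Nat.cast_sub h2.1.2]
      congr 3 <;> push_cast <;> ring
    have e : m - (m - i) - (m - s - 1) - 1 = i + s - m := by omega
    rw [hSp, hSz, e, one_div_one_div]
    ring
  -- Off ties the counts always lie in one of the two regions, so this event is contained in a null
  -- set.
  · rw [measureReal_def, measure_mono_null (t := {ω | ¬ _}) ?_ (ae_iff.1 hae), ENNReal.toReal_zero]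
    rintro ω ⟨hk, hi⟩ hω
    have e1 := precedence_swap_add hs hω.2.2
    have e2 := precedence_add_exceedance_swap hr hω.2.2
    have e3 := precedence_exceedance_bounds hs hr hω.1 hω.2.1 hω.2.2
    omega

/-- The distribution function of `V_ρ`. -/
theorem IsLehmannTwoSample.real_sidakStat_le (hη : 0 < η) (h : IsLehmannTwoSample P η F X Y)
    {ρ : ℝ} (hρ : ρ < 1) (hm : 0 < m) (hn : 0 < n) (v : ℕ) :
    P.real {ω | sidakStat ρ hρ hm hn (fun j => X j ω) (fun j => Y j ω) ≤ v} =
      ∑ i ∈ Finset.range (v + 1), ∑ k ∈ Finset.range (v - i + 1),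
        lehmannPmf m n ⌊ρ * m⌋₊ ⌊ρ * n⌋₊ η k i := by
  have hA := measurable_exceedance h.measurable_X h.measurable_Y (floor_mul_lt hρ hm)
  have hB := measurable_precedence h.measurable_X h.measurable_Y (floor_mul_lt hρ hn)
  simp only [← h.real_exceedance_precedence hη (floor_mul_lt hρ hm) (floor_mul_lt hρ hn)]
  rw [Finset.sum_sigma', ← measureReal_biUnion_finset]
  · congr 1
    ext ω
    simp only [sidakStat, Set.mem_iUnion, Set.mem_ofPred_eq, Finset.mem_sigma, Finset.mem_range]
    constructor
    · intro hle
      refine ⟨⟨precedence _ (floor_mul_lt hρ hn) (fun j => X j ω) (fun j => Y j ω),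
        exceedance _ (floor_mul_lt hρ hm) (fun j => X j ω) (fun j => Y j ω)⟩, ⟨?_, ?_⟩, rfl, rfl⟩
      all_goals simp only; omega
    · rintro ⟨⟨i, k⟩, ⟨h1, h2⟩, h3, h4⟩
      simp only at h1 h2 h3 h4
      omega
  · rintro ⟨i, k⟩ - ⟨i', k'⟩ - hne
    refine Set.disjoint_left.2 ?_
    rintro ω ⟨h1, h2⟩ ⟨h3, h4⟩
    simp only at h1 h2 h3 h4
    exact hne (by rw [← h1, ← h2, ← h3, ← h4])
  · rintro ⟨i, k⟩ -
    exact (hA (measurableSet_singleton k)).inter (hB (measurableSet_singleton i))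

end

theorem theorem3 {Ω : Type*} [MeasurableSpace Ω] (P : Measure Ω) [IsProbabilityMeasure P]
    {m n : ℕ} (η : ℝ) (hη : 1 < η) (F : ℝ → ℝ) (X : Fin m → Ω → ℝ) (Y : Fin n → Ω → ℝ)
    (hXY : IsLehmannTwoSample P η F X Y) :
    -- the joint probability mass function of `(A_s, B_r)`
    (∀ (s r : ℕ) (hs : s < m) (hr : r < n) (k i : ℕ),
      P.real {ω | exceedance s hs (fun j => X j ω) (fun j => Y j ω) = k ∧
          precedence r hr (fun j => X j ω) (fun j => Y j ω) = i} =
        lehmannPmf m n s r η k i) ∧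
    -- the cumulative distribution function of `V_ρ`
    (∀ (ρ : ℝ) (_ : 0 ≤ ρ) (hρ : ρ < 1) (hm : 0 < m) (hn : 0 < n) (v : ℕ),
      P.real {ω | sidakStat ρ hρ hm hn (fun j => X j ω) (fun j => Y j ω) ≤ v} =
        ∑ i ∈ Finset.range (v + 1), ∑ k ∈ Finset.range (v - i + 1),
          lehmannPmf m n ⌊ρ * m⌋₊ ⌊ρ * n⌋₊ η k i) ∧
    -- the law of `V_ρ` is the same for every continuous `F`
    (∀ (ρ : ℝ) (_ : 0 ≤ ρ) (hρ : ρ < 1) (hm : 0 < m) (hn : 0 < n)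
      {Ω' : Type*} [MeasurableSpace Ω'] (P' : Measure Ω') [IsProbabilityMeasure P']
      (F' : ℝ → ℝ) (X' : Fin m → Ω' → ℝ) (Y' : Fin n → Ω' → ℝ),
      IsLehmannTwoSample P' η F' X' Y' →
        P.map (fun ω => sidakStat ρ hρ hm hn (fun j => X j ω) (fun j => Y j ω)) =
          P'.map (fun ω => sidakStat ρ hρ hm hn (fun j => X' j ω) (fun j => Y' j ω))) := by
  have hη0 : 0 < η := one_pos.trans hη
  refine ⟨fun s r hs hr k i => hXY.real_exceedance_precedence hη0 hs hr k i,
    fun ρ _ hρ hm hn v => hXY.real_sidakStat_le hη0 hρ hm hn v, ?_⟩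
  intro ρ _ hρ hm hn Ω' _ P' _ F' X' Y' hXY'
  have hV := hXY.measurable_sidakStat hρ hm hn
  have hV' := hXY'.measurable_sidakStat hρ hm hn
  have := Measure.isProbabilityMeasure_map (μ := P) hV.aemeasurable
  have := Measure.isProbabilityMeasure_map (μ := P') hV'.aemeasurable
  -- The distribution function determines the law, and its formula involves neither `F` nor the
  -- probability space.
  refine Measure.ext_of_Iic _ _ fun v => ?_
  rw [← ENNReal.toReal_eq_toReal_iff' (measure_ne_top _ _) (measure_ne_top _ _), ← measureReal_def,
    ← measureReal_def, map_measureReal_apply hV measurableSet_Iic,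
    map_measureReal_apply hV' measurableSet_Iic]
  exact (hXY.real_sidakStat_le hη0 hρ hm hn v).trans (hXY'.real_sidakStat_le hη0 hρ hm hn v).symm
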